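/- Let $N\ge 2$, $0<\rho<1$, $\varepsilon>0$, $\sigma>0$. Set $\tau=N^{-\rho}$ and $R=\sqrt{\tau N^{-\varepsilon}}=N^{-\rho/2-\varepsilon/2}$. Let $\gamma_1,\dots,\gamma_{N-1}$ be the classical locations of the semicircle law, defined by $$\int_{-\infty}^{\gamma_\alpha}\frac{1}{2\pi}\sqrt{[4-x^2]_+}\,\mathrm dx=\frac{\alpha}{N}\qquad(\alpha=1,\dots,N-1),$$ and set $\gamma_N=2+\sigma$. For $n\ge1$ let $\Sigma_n=\{x\in\mathbb R^n: x_1<\dots<x_n\}$. For $\mathbf x\in\Sigma_N$ define $$\mathcal H(\mathbf x)=\sum_{i=1}^N\frac14x_i^2-\frac1N\sum_{1\le i<j\le N}\log|x_i-x_j|,\qquad W(\mathbf x)=\sum_{i=1}^N\frac{1}{2R^2}(x_i-\gamma_i)^2 ,$$ and $Z=\int_{\Sigma_N}e^{-N\mathcal H(\mathbf x)}\,\mathrm d\mathbf x$, $\widetilde Z=\int_{\Sigma_N}e^{-N\mathcal H(\mathbf x)-NW(\mathbf x)}\,\mathrm d\mathbf x$. Let $\mu(\mathrm d\mathbf x)=Z^{-1}e^{-N\mathcal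 H(\mathbf x)}\mathbf 1(\mathbf x\in\Sigma_N)\,\mathrm d\mathbf x$ be the GOE equilibrium measure, and let $\omega=\psi\mu$ with $\psi=\frac{Z}{\widetilde Z}e^{-NW}$ be the pseudo-equilibrium measure; its Lebesgue density on $\Sigma_N$ is $\omega(\mathbf x)=\widetilde Z^{-1}e^{-N\mathcal H(\mathbf x)-NW(\mathbf x)}$. Let $\widehat\omega$ be the marginal of $\omega$ on $\widehat x=(x_1,\dots,x_{N-1})$, whose density on $\Sigma_{N-1}$ is $\widehat\omega(\widehat x)=\int_{x_{N-1}}^\infty\omega(\widehat x,x_N)\,\mathrm dx_N$. Then $\omega$ is a probability measure, and there is a function $V$ on $\Sigma_{N-1}$, twice continuously differentiable there, such that for all $\widehat x\in\Sigma_{N-1}$ $$\widehat\omega(\widehat x)=\frac1{\widetilde Z}\,e^{-N\widehat{\mathcal H}(\widehat x)},\qquad \widehat{\mathcal H}(\widehat x)=-\frac1N\sum_{1\le i<j\le N-1}\log|x_i-x_j|+V(\widehat x),$$ and $\nabla^2V(\widehat x)\ge R^{-2}$ as quadratic forms, i.e. $\langle v,\nabla^2V(\widehat x)v\rangle\ge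 R^{-2}\sum_{i=1}^{N-1}v_i^2$ for all $v\in\mathbb R^{N-1}$. As a measure, $\widehat\omega$ is carried by $\Sigma_{N-1}$ and has this density there. -/

import Mathlib

open MeasureTheory Set Filter Topology

noncomputable section

namespace PseudoEquilibrium

/-! ### The semicircle law and the classical eigenvalue locations -/

/-- The density of the semicircle law. -/
def rhoSC (E : ℝ) : ℝ := 1 / (2 * Real.pi) * Real.sqrt (max (4 - E ^ 2) 0)

/-- The integrated density of the semicircle law. -/
def nSC (E : ℝ) : ℝ := ∫ x in Iic E, rhoSC x

/-- The classical location of the `α`-th eigenvalue: the `α / N`-quantile of the semicircle law.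
It solves `nSC γ = α / N`, see `nSC_classicalLocation`. -/
def classicalLocation (N α : ℕ) : ℝ := sInf {E : ℝ | (α : ℝ) / N ≤ nSC E}

lemma rhoSC_nonneg (E : ℝ) : 0 ≤ rhoSC E := by unfold rhoSC; positivity

lemma continuous_rhoSC : Continuous rhoSC := by unfold rhoSC; fun_prop

lemma rhoSC_eq_zero_of_notMem {E : ℝ} (h : E ∉ Icc (-2 : ℝ) 2) : rhoSC E = 0 := by
  have : 4 - E ^ 2 ≤ 0 := by
    by_contra! h'
    exact h ⟨by nlinarith, by nlinarith⟩
  simp [rhoSC, max_eq_right this]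

lemma integrable_rhoSC : Integrable rhoSC :=
  continuous_rhoSC.integrable_of_hasCompactSupport
    (HasCompactSupport.intro isCompact_Icc fun _ hx => rhoSC_eq_zero_of_notMem hx)

lemma nSC_eq_zero {E : ℝ} (h : E ≤ -2) : nSC E = 0 := by
  unfold nSC
  have : ∀ x ∈ Iio E, rhoSC x = 0 := fun x hx =>
    rhoSC_eq_zero_of_notMem fun h' => by
      have h1 : x < E := hx
      have h2 := h'.1
      linarith
  rw [integral_Iic_eq_integral_Iio]
  exact setIntegral_eq_zero_of_forall_eq_zero this

lemma nSC_sub (a b : ℝ) : nSC b - nSC a = ∫ x in a..b, rhoSC x :=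
  intervalIntegral.integral_Iic_sub_Iic integrable_rhoSC.integrableOn
    integrable_rhoSC.integrableOn

lemma continuous_nSC : Continuous nSC := by
  have h : nSC = fun b => nSC 0 + ∫ x in (0 : ℝ)..b, rhoSC x := by
    funext b
    rw [← nSC_sub]
    ring
  rw [h]
  exact continuous_const.add
    (intervalIntegral.continuous_primitive (fun _ _ => integrable_rhoSC.intervalIntegrable) 0)

lemma nSC_two : nSC 2 = 1 := by
  have h := nSC_sub (-2) 2
  rw [nSC_eq_zero le_rfl, sub_zero] at h
  rw [h]
  have h2 : ∀ x ∈ uIcc (-2 : ℝ) 2,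
      rhoSC x = (1 / Real.pi) * Real.sqrt (1 - (x / 2) ^ 2) := by
    intro x hx
    rw [uIcc_of_le (by norm_num)] at hx
    have h0 : 0 ≤ 1 - (x / 2) ^ 2 := by nlinarith [hx.1, hx.2]
    have h4 : max (4 - x ^ 2) 0 = 2 ^ 2 * (1 - (x / 2) ^ 2) := by
      rw [max_eq_left (by nlinarith)]
      ring
    rw [rhoSC, h4, Real.sqrt_mul (by positivity), Real.sqrt_sq (by norm_num)]
    field_simp
  rw [intervalIntegral.integral_congr h2, intervalIntegral.integral_const_mul,
    intervalIntegral.integral_comp_div (fun y => Real.sqrt (1 - y ^ 2)) (by norm_num : (2 : ℝ) ≠ 0)]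
  norm_num [integral_sqrt_one_sub_sq]
  field_simp

theorem nSC_classicalLocation {N α : ℕ} (h1 : 1 ≤ α) (h2 : α ≤ N) :
    nSC (classicalLocation N α) = (α : ℝ) / N := by
  have hα : (1 : ℝ) ≤ α := by exact_mod_cast h1
  have hαN : (α : ℝ) ≤ N := by exact_mod_cast h2
  have hN : (0 : ℝ) < N := by linarith
  have ht0 : 0 < (α : ℝ) / N := by positivity
  have ht1 : (α : ℝ) / N ≤ 1 := (div_le_one hN).2 hαN
  set S : Set ℝ := {E : ℝ | (α : ℝ) / N ≤ nSC E} with hS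
  have hne : S.Nonempty := ⟨2, by simpa [hS, nSC_two] using ht1⟩
  have hlow : ∀ E ∈ S, -2 ≤ E := by
    intro E hE
    by_contra! hlt
    have h3 : (α : ℝ) / N ≤ nSC E := hE
    rw [nSC_eq_zero hlt.le] at h3
    linarith
  have hbdd : BddBelow S := ⟨-2, hlow⟩
  have hcl : IsClosed S := isClosed_le continuous_const continuous_nSC
  have hmem : sInf S ∈ S := hcl.csInf_mem hne hbdd
  refine le_antisymm ?_ hmem
  by_contra! hgt
  have hge : -2 ≤ sInf S := hlow _ hmem
  obtain ⟨c, hc, hc'⟩ := intermediate_value_Icc hge continuous_nSC.continuousOn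
    (show (α : ℝ) / N ∈ Icc (nSC (-2)) (nSC (sInf S)) from
      ⟨by rw [nSC_eq_zero le_rfl]; exact ht0.le, hmem⟩)
  have hcS : c ∈ S := hc'.ge
  have hce : c = sInf S := le_antisymm hc.2 (csInf_le hbdd hcS)
  have hgt' : (α : ℝ) / N < nSC (sInf S) := hgt
  rw [← hce, hc'] at hgt'
  exact lt_irrefl _ hgt'

/-- The centres of the confining potential: the classical locations for the first `N - 1`
eigenvalues, and `2 + σ` for the largest one. The eigenvalue `x_α` has the index `α - 1`. -/
def gammaLoc (N : ℕ) (σ : ℝ) (i : Fin N) : ℝ :=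
  if (i : ℕ) + 1 = N then 2 + σ else classicalLocation N ((i : ℕ) + 1)

/-! ### The equilibrium measure -/

/-- The set of strictly ordered configurations `x_1 < ⋯ < x_n`. -/
def ordered (n : ℕ) : Set (Fin n → ℝ) := {x | StrictMono x}

/-- `∑_{i < j} log |x_i - x_j|`. -/
def logSum {n : ℕ} (x : Fin n → ℝ) : ℝ :=
  ∑ i, ∑ j ∈ Finset.Ioi i, Real.log |x i - x j|

/-- The equilibrium Hamiltonian. -/
def hamiltonian (N : ℕ) (x : Fin N → ℝ) : ℝ :=
  ∑ i, (1 / 4 : ℝ) * x i ^ 2 - 1 / (N : ℝ) * logSum x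

/-- The normalization of the equilibrium measure. -/
def partitionZ (N : ℕ) : ℝ :=
  ∫ x in ordered N, Real.exp (-(N : ℝ) * hamiltonian N x)

/-- The equilibrium measure: the law of the ordered eigenvalues of the GOE. -/
def equilibriumMeasure (N : ℕ) : Measure (Fin N → ℝ) :=
  (volume.restrict (ordered N)).withDensity fun x =>
    ENNReal.ofReal ((partitionZ N)⁻¹ * Real.exp (-(N : ℝ) * hamiltonian N x))

/-! ### The pseudo-equilibrium measure -/

/-- The time scale `τ`. -/
def timeScale (N : ℕ) (ρ : ℝ) : ℝ := (N : ℝ) ^ (-ρ)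

/-- The length scale `R`. -/
def scaleR (N : ℕ) (ρ ε : ℝ) : ℝ := Real.sqrt (timeScale N ρ * (N : ℝ) ^ (-ε))

/-- The confining potential `W`. -/
def confinement (N : ℕ) (ρ ε σ : ℝ) (x : Fin N → ℝ) : ℝ :=
  ∑ i, 1 / (2 * scaleR N ρ ε ^ 2) * (x i - gammaLoc N σ i) ^ 2

/-- The normalization of the pseudo-equilibrium measure. -/
def partitionZtilde (N : ℕ) (ρ ε σ : ℝ) : ℝ :=
  ∫ x in ordered N,
    Real.exp (-(N : ℝ) * hamiltonian N x - (N : ℝ) * confinement N ρ ε σ x)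

/-- The density `ψ` of the pseudo-equilibrium measure with respect to the equilibrium measure. -/
def psi (N : ℕ) (ρ ε σ : ℝ) (x : Fin N → ℝ) : ℝ :=
  partitionZ N / partitionZtilde N ρ ε σ * Real.exp (-(N : ℝ) * confinement N ρ ε σ x)

/-- The pseudo-equilibrium measure `ω`. -/
def omega (N : ℕ) (ρ ε σ : ℝ) : Measure (Fin N → ℝ) :=
  (equilibriumMeasure N).withDensity fun x => ENNReal.ofReal (psi N ρ ε σ x)

/-- The density of `ω` with respect to Lebesgue measure, on the ordered configurations. -/
def omegaDensity (N : ℕ) (ρ ε σ : ℝ) (x : Fin N → ℝ) : ℝ :=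
  (partitionZtilde N ρ ε σ)⁻¹ *
    Real.exp (-(N : ℝ) * hamiltonian N x - (N : ℝ) * confinement N ρ ε σ x)

/-! ### The marginal on the first `N - 1` eigenvalues, where `N = m + 2` -/

/-- The marginal measure of `ω`, obtained by integrating out the largest eigenvalue. -/
def omegaHat (m : ℕ) (ρ ε σ : ℝ) : Measure (Fin (m + 1) → ℝ) :=
  (omega (m + 2) ρ ε σ).map fun x i => x (Fin.castSucc i)

/-- The marginal density: the integral of the density of `ω` over `x_N` in `(x_{N-1}, ∞)`. -/
def omegaHatDensity (m : ℕ) (ρ ε σ : ℝ) (xhat : Fin (m + 1) → ℝ) : ℝ :=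
  ∫ y in Ioi (xhat (Fin.last m)),
    omegaDensity (m + 2) ρ ε σ (Fin.snoc (α := fun _ => ℝ) xhat y)

/-- The Hamiltonian of the first `N - 1` eigenvalues with potential `V`: the interaction keeps the
prefactor `1 / N`. -/
def hamiltonianHat (m : ℕ) (V : (Fin (m + 1) → ℝ) → ℝ) (xhat : Fin (m + 1) → ℝ) : ℝ :=
  -(1 / ((m + 2 : ℕ) : ℝ)) * logSum xhat + V xhat

end PseudoEquilibrium

end

open MeasureTheory Set Filter Topology

noncomputable section

namespace PseudoEquilibrium

/-! Write `N = m + 2`. Multiplying the Hamiltonian by `N` cancels the `1 / N` of the interaction, so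
the largest particle `y` enters the density of `ω` only through `w y * ∏ i, (y - x i)` with a
Gaussian weight `w` (`hamiltonian_add_confinement_snoc`). Integrating `y` over its half line gives
`tailIntegral w x`, hence `V = quadHat - (1 / N) * log (tailIntegral w)`. The confinement alone
contributes `R⁻²` to the Hessian of `quadHat`, so it suffices that `tailIntegral w` is log-concave.

This is Prékopa's theorem. After the shift `y = u + x_{N-1}` the domain is a fixed half line and the
integrand is jointly log-concave in `(u, x)`, being a Gaussian times positive affine factors. The
one-dimensional Prékopa–Leindler inequality is proved by monotone transport. Convexity of `V - R⁻²
|x|² / 2`, with `V` of class C², becomes the Hessian bound by restriction to lines. The statements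
about measures follow from Tonelli and a Gaussian majorant. -/

/-! ### Monotone transport and Prékopa–Leindler on the half line -/

/-- The primitive of a function that is continuous and positive on the half line has a
differentiable inverse. -/
lemma exists_inverse_primitive {g : ℝ → ℝ} (hg : Continuous g) (hpos : ∀ y, 0 < y → 0 < g y)
    (hint : IntegrableOn g (Ioi 0)) :
    ∃ S : ℝ → ℝ, ∀ c ∈ Ioo 0 (∫ y in Ioi 0, g y), 0 < S c ∧ HasDerivAt S (g (S c))⁻¹ c := by
  set G : ℝ → ℝ := fun z => ∫ y in (0 : ℝ)..z, g y with hG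
  have hderiv : ∀ z, HasDerivAt G (g z) z := fun z => hg.integral_hasStrictDerivAt 0 z |>.hasDerivAt
  have hcont : Continuous G := continuous_iff_continuousAt.2 fun z => (hderiv z).continuousAt
  have hmono : StrictMonoOn G (Ici 0) := by
    refine strictMonoOn_of_deriv_pos (convex_Ici 0) hcont.continuousOn fun z hz => ?_
    rw [interior_Ici] at hz
    rw [(hderiv z).deriv]
    exact hpos z hz
  have h0 : G 0 = 0 := by simp [hG]
  have hlim : Tendsto G atTop (𝓝 (∫ y in Ioi 0, g y)) :=
    intervalIntegral_tendsto_integral_Ioi 0 hint tendsto_id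
  have hlt : ∀ z, 0 < z → G z ∈ Ioo 0 (∫ y in Ioi 0, g y) := by
    intro z hz
    refine ⟨h0 ▸ hmono (mem_Ici.2 le_rfl) (mem_Ici.2 hz.le) hz, ?_⟩
    -- The intermediate point `z + 1` keeps the inequality with the limit strict.
    refine lt_of_lt_of_le (hmono (mem_Ici.2 hz.le) (mem_Ici.2 (by linarith : (0 : ℝ) ≤ z + 1))
      (by linarith)) (ge_of_tendsto hlim ?_)
    filter_upwards [eventually_ge_atTop (z + 1)] with y hy
    exact hmono.monotoneOn (mem_Ici.2 (by linarith)) (mem_Ici.2 (by linarith)) hy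
  have hex : ∀ c, ∃ z, c ∈ Ioo 0 (∫ y in Ioi 0, g y) → 0 < z ∧ G z = c := by
    intro c
    by_cases hc : c ∈ Ioo 0 (∫ y in Ioi 0, g y)
    · obtain ⟨b, hb, hb0⟩ := ((hlim.eventually (lt_mem_nhds hc.2)).and (eventually_gt_atTop 0)).exists
      obtain ⟨z, hz, hzc⟩ := intermediate_value_Icc hb0.le hcont.continuousOn
        (show c ∈ Icc (G 0) (G b) from ⟨h0.le.trans hc.1.le, hb.le⟩)
      refine ⟨z, fun _ => ⟨lt_of_le_of_ne hz.1 ?_, hzc⟩⟩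
      rintro rfl
      exact hc.1.ne' (hzc ▸ h0)
    · exact ⟨0, fun h => absurd h hc⟩
  choose S hS using hex
  have hSmono : StrictMonoOn S (Ioo 0 (∫ y in Ioi 0, g y)) := by
    intro c hc d hd hcd
    refine (hmono.lt_iff_lt (mem_Ici.2 (hS c hc).1.le) (mem_Ici.2 (hS d hd).1.le)).1 ?_
    rwa [(hS c hc).2, (hS d hd).2]
  -- A monotone function whose image is a neighbourhood of its value has no jump there. This gives
  -- the continuity needed to differentiate the inverse.
  have himage : Ioi 0 ⊆ S '' Ioo 0 (∫ y in Ioi 0, g y) := by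
    intro z hz
    have hz' := hlt z hz
    exact ⟨G z, hz', hmono.injOn (mem_Ici.2 (hS _ hz').1.le) (mem_Ici.2 (le_of_lt hz)) (hS _ hz').2⟩
  refine ⟨S, fun c hc => ⟨(hS c hc).1, ?_⟩⟩
  have hnhds : Ioo 0 (∫ y in Ioi 0, g y) ∈ 𝓝 c := isOpen_Ioo.mem_nhds hc
  have hScont : ContinuousAt S c :=
    continuousAt_of_monotoneOn_of_image_mem_nhds hSmono.monotoneOn hnhds
      (mem_of_superset (Ioi_mem_nhds (hS c hc).1) himage)
  exact HasDerivAt.of_local_left_inverse hScont (hderiv _) (hpos _ (hS c hc).1).ne'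
    (by filter_upwards [hnhds] with y hy using (hS y hy).2)

lemma integral_Ioi_pos {f : ℝ → ℝ} {a : ℝ} (hpos : ∀ y, a < y → 0 < f y)
    (hint : IntegrableOn f (Ioi a)) : 0 < ∫ y in Ioi a, f y := by
  rw [setIntegral_pos_iff_support_of_nonneg_ae
    ((ae_restrict_iff' measurableSet_Ioi).2 (ae_of_all _ fun y hy => (hpos y hy).le)) hint]
  have : Function.support f ∩ Ioi a = Ioi a :=
    inter_eq_right.2 fun y hy => (hpos y hy).ne'
  simp [this]

/-- The Prékopa–Leindler inequality on the half line, for continuous positive functions. -/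
theorem prekopa_leindler_Ioi {f g h : ℝ → ℝ} {a b : ℝ} (ha : 0 < a) (hb : 0 < b) (hab : a + b = 1)
    (hf : Continuous f) (hg : Continuous g) (hfpos : ∀ y, 0 < y → 0 < f y)
    (hgpos : ∀ y, 0 < y → 0 < g y) (hfint : IntegrableOn f (Ioi 0))
    (hgint : IntegrableOn g (Ioi 0)) (hhint : IntegrableOn h (Ioi 0)) (hh : ∀ y, 0 < y → 0 ≤ h y)
    (hle : ∀ y z, 0 < y → 0 < z → f y ^ a * g z ^ b ≤ h (a * y + b * z)) :
    (∫ y in Ioi 0, f y) ^ a * (∫ y in Ioi 0, g y) ^ b ≤ ∫ y in Ioi 0, h y := by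
  set A := ∫ y in Ioi 0, f y with hA
  set B := ∫ y in Ioi 0, g y with hB
  have hApos : 0 < A := integral_Ioi_pos hfpos hfint
  have hBpos : 0 < B := integral_Ioi_pos hgpos hgint
  obtain ⟨S, hS⟩ := exists_inverse_primitive hg hgpos hgint
  set F : ℝ → ℝ := fun z => ∫ y in (0 : ℝ)..z, f y with hF
  have hderiv : ∀ z, HasDerivAt F (f z) z := fun z => hf.integral_hasStrictDerivAt 0 z |>.hasDerivAt
  have hFmem : ∀ y, 0 < y → F y * (B / A) ∈ Ioo 0 B := by
    intro y hy
    have h1 : 0 < F y := intervalIntegral.intervalIntegral_pos_of_pos_on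
      (hf.intervalIntegrable _ _) (fun x hx => hfpos x hx.1) hy
    have h2 : 0 < ∫ x in Ioi y, f x := integral_Ioi_pos (fun x hx => hfpos x (hy.trans hx))
      (hfint.mono_set (Ioi_subset_Ioi hy.le))
    have h3 : F y + ∫ x in Ioi y, f x = A :=
      intervalIntegral.integral_interval_add_Ioi hfint (hfint.mono_set (Ioi_subset_Ioi hy.le))
    refine ⟨by positivity, ?_⟩
    calc F y * (B / A) < A * (B / A) := by gcongr; linarith
      _ = B := by field_simp
  -- `T` transports the density `f / A` to `g / B`. Only `T > 0` and `g (T y) * T' y = f y * (B /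
  -- A)` are used below.
  set T : ℝ → ℝ := fun y => S (F y * (B / A)) with hT
  have hTpos : ∀ y, 0 < y → 0 < T y := fun y hy => (hS _ (hFmem y hy)).1
  have hTderiv : ∀ y, 0 < y → HasDerivAt T ((g (T y))⁻¹ * (f y * (B / A))) y := fun y hy =>
    (hS _ (hFmem y hy)).2.comp y ((hderiv y).mul_const _)
  set φ : ℝ → ℝ := fun y => a * y + b * T y with hφ
  set φ' : ℝ → ℝ := fun y => a * 1 + b * ((g (T y))⁻¹ * (f y * (B / A))) with hφ'
  have hφderiv : ∀ y, 0 < y → HasDerivAt φ (φ' y) y := fun y hy =>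
    ((hasDerivAt_id y).const_mul a).add ((hTderiv y hy).const_mul b)
  have hφ'pos : ∀ y, 0 < y → 0 < φ' y := by
    intro y hy
    have := hfpos y hy
    have := hgpos _ (hTpos y hy)
    positivity
  have hφmono : StrictMonoOn φ (Ioi 0) := by
    refine strictMonoOn_of_deriv_pos (convex_Ioi 0)
      (fun y hy => (hφderiv y hy).continuousAt.continuousWithinAt) fun y hy => ?_
    rw [interior_Ioi] at hy
    rw [(hφderiv y hy).deriv]
    exact hφ'pos y hy
  have himage : φ '' Ioi 0 ⊆ Ioi 0 := by
    rintro _ ⟨y, hy, rfl⟩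
    have h1 : 0 < y := hy
    have h2 := hTpos y hy
    exact mem_Ioi.2 (by positivity)
  have hw : ∀ y ∈ Ioi (0 : ℝ), HasDerivWithinAt φ (φ' y) (Ioi 0) y := fun y hy =>
    (hφderiv y hy).hasDerivWithinAt
  have hint' : IntegrableOn (fun y => |φ' y| • h (φ y)) (Ioi 0) :=
    (integrableOn_image_iff_integrableOn_abs_deriv_smul measurableSet_Ioi hw hφmono.injOn h).1
      (hhint.mono_set himage)
  -- Weighted AM–GM gives `φ' = a * 1 + b * T' ≥ T' ^ b`; the powers of `g (T y)` then cancel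
  -- against those in the hypothesis on `h`.
  have hpt : ∀ y ∈ Ioi (0 : ℝ), f y * (B / A) ^ b ≤ |φ' y| • h (φ y) := by
    intro y hy
    have hfy := hfpos y hy
    have hgy := hgpos _ (hTpos y hy)
    rw [abs_of_pos (hφ'pos y hy), smul_eq_mul]
    have h1 : ((g (T y))⁻¹ * (f y * (B / A))) ^ b ≤ φ' y := by
      have := Real.geom_mean_le_arith_mean2_weighted ha.le hb.le zero_le_one
        (by positivity : 0 ≤ (g (T y))⁻¹ * (f y * (B / A))) hab
      simpa [hφ'] using this
    calc f y * (B / A) ^ b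
        = ((g (T y))⁻¹ * (f y * (B / A))) ^ b * (f y ^ a * g (T y) ^ b) := by
          rw [Real.mul_rpow (by positivity) (by positivity),
            Real.mul_rpow hfy.le (by positivity), Real.inv_rpow hgy.le]
          have h2 : f y ^ b * f y ^ a = f y := by
            rw [← Real.rpow_add hfy, add_comm b a, hab, Real.rpow_one]
          have h3 : (g (T y) ^ b)⁻¹ * g (T y) ^ b = 1 :=
            inv_mul_cancel₀ (Real.rpow_pos_of_pos hgy b).ne'
          calc f y * (B / A) ^ b = (f y ^ b * f y ^ a) * (B / A) ^ b *
              ((g (T y) ^ b)⁻¹ * g (T y) ^ b) := by rw [h2, h3, mul_one]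
            _ = _ := by ring
      _ ≤ φ' y * h (φ y) := by
          exact mul_le_mul h1 (hle y (T y) hy (hTpos y hy)) (by positivity) (hφ'pos y hy).le
  calc A ^ a * B ^ b = A * (B / A) ^ b := by
        rw [Real.div_rpow hBpos.le hApos.le]
        have : A ^ a * A ^ b = A := by rw [← Real.rpow_add hApos, hab, Real.rpow_one]
        have h4 := (Real.rpow_pos_of_pos hApos b).ne'
        field_simp
        exact this
    _ = ∫ y in Ioi 0, f y * (B / A) ^ b := by rw [integral_mul_const]
    _ ≤ ∫ y in Ioi 0, |φ' y| • h (φ y) :=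
        setIntegral_mono_on (hfint.mul_const _) hint' measurableSet_Ioi hpt
    _ = ∫ y in φ '' Ioi 0, h y :=
        (integral_image_eq_integral_abs_deriv_smul measurableSet_Ioi hw hφmono.injOn h).symm
    _ ≤ ∫ y in Ioi 0, h y :=
        setIntegral_mono_set hhint
          ((ae_restrict_iff' measurableSet_Ioi).2 (ae_of_all _ fun y hy => hh y hy))
          himage.eventuallyLE

/-! ### The ordered cone, and Hessian bounds from strong convexity -/

lemma isOpen_ordered (n : ℕ) : IsOpen (ordered n) := by
  have : ordered n = ⋂ i : Fin n, ⋂ j : Fin n, {x | i < j → x i < x j} := by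
    ext x
    simp [ordered, StrictMono]
  rw [this]
  refine isOpen_iInter_of_finite fun i => isOpen_iInter_of_finite fun j => ?_
  by_cases h : i < j
  · simpa [h] using isOpen_lt (continuous_apply i) (continuous_apply j)
  · simp [h]

lemma convex_ordered (n : ℕ) : Convex ℝ (ordered n) := by
  intro x hx y hy a b ha hb hab i j hij
  have h1 := hx hij
  have h2 := hy hij
  simp only [Pi.add_apply, Pi.smul_apply, smul_eq_mul]
  rcases ha.eq_or_lt with rfl | ha
  · have : b = 1 := by linarith
    subst this
    linarith
  · nlinarith [mul_lt_mul_of_pos_left h1 ha, mul_le_mul_of_nonneg_left h2.le hb]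

/-- A twice differentiable function which is strongly convex on an open set has its Hessian bounded
from below there. -/
lemma le_iteratedFDeriv_two_of_convexOn {n : ℕ} {s : Set (Fin n → ℝ)} (hs : IsOpen s)
    {V : (Fin n → ℝ) → ℝ} {c : ℝ} (hV : ContDiffOn ℝ 2 V s)
    (hconv : ConvexOn ℝ s fun x => V x - c / 2 * ∑ i, x i ^ 2) {x : Fin n → ℝ} (hx : x ∈ s)
    (v : Fin n → ℝ) : c * ∑ i, v i ^ 2 ≤ iteratedFDeriv ℝ 2 V x ![v, v] := by
  set ℓ : ℝ → Fin n → ℝ := fun t => x + t • v with hℓ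
  have hℓderiv : ∀ t, HasDerivAt ℓ v t := fun t =>
    (((hasDerivAt_id t).smul_const v).const_add x).congr_deriv (one_smul ℝ v)
  have hℓcont : Continuous ℓ := by fun_prop
  have hℓ0 : ℓ 0 = x := by simp [hℓ]
  set U : Set ℝ := ℓ ⁻¹' s with hU
  have hUopen : IsOpen U := hs.preimage hℓcont
  have h0 : (0 : ℝ) ∈ U := by simpa [hU, hℓ0] using hx
  have hψconv : ConvexOn ℝ U fun t => V (ℓ t) - c / 2 * ∑ i, (ℓ t i) ^ 2 := by
    have := hconv.comp_affineMap (AffineMap.lineMap x (x + v))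
    have h2 : ∀ t : ℝ, AffineMap.lineMap x (x + v) t = ℓ t := fun t => by
      simp [AffineMap.lineMap_apply, hℓ, add_comm]
    have h3 : (AffineMap.lineMap x (x + v) : ℝ → Fin n → ℝ) = ℓ := funext h2
    simpa [h3, hU, Function.comp_def] using this
  set ψ' : ℝ → ℝ := fun t => fderiv ℝ V (ℓ t) v - c * ∑ i, ℓ t i * v i with hψ'
  have hψderiv : ∀ t ∈ U, HasDerivAt (fun t => V (ℓ t) - c / 2 * ∑ i, (ℓ t i) ^ 2) (ψ' t) t := by
    intro t ht
    have h1 : HasFDerivAt V (fderiv ℝ V (ℓ t)) (ℓ t) :=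
      ((hV.contDiffAt (hs.mem_nhds ht)).differentiableAt (by norm_num)).hasFDerivAt
    have h2 : HasDerivAt (fun t => ∑ i, (ℓ t i) ^ 2) (∑ i, 2 * (ℓ t i * v i)) t := by
      refine HasDerivAt.fun_sum fun i _ => ?_
      refine (((hasDerivAt_pi.1 (hℓderiv t)) i).pow 2).congr_deriv ?_
      simp [mul_assoc]
    refine ((h1.comp_hasDerivAt t (hℓderiv t)).sub (h2.const_mul (c / 2))).congr_deriv ?_
    simp only [hψ', ← Finset.mul_sum]
    ring
  -- Along the line the derivative of a convex function is monotone, so its own derivative at `0` is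
  -- nonnegative.
  have hmono : MonotoneOn ψ' U := by
    have := hψconv.monotoneOn_deriv fun t ht => (hψderiv t ht).differentiableAt
    exact this.congr fun t ht => (hψderiv t ht).deriv
  have hψ'deriv : HasDerivAt ψ' (iteratedFDeriv ℝ 2 V x ![v, v] - c * ∑ i, v i ^ 2) 0 := by
    have h1 : HasFDerivAt (fderiv ℝ V) (fderiv ℝ (fderiv ℝ V) x) (ℓ 0) := by
      rw [hℓ0]
      exact (((hV.contDiffAt (hs.mem_nhds hx)).fderiv_right (m := 1) (by norm_num)).differentiableAt
        (by norm_num)).hasFDerivAt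
    have h2 := (h1.comp_hasDerivAt 0 (hℓderiv 0)).clm_apply (hasDerivAt_const 0 v)
    have h3 : HasDerivAt (fun t => ∑ i, ℓ t i * v i) (∑ i, v i * v i) 0 :=
      HasDerivAt.fun_sum fun i _ => ((hasDerivAt_pi.1 (hℓderiv 0)) i).mul_const (v i)
    refine (h2.sub (h3.const_mul c)).congr_deriv ?_
    simp [iteratedFDeriv_two_apply, sq]
  have h4 : 0 ≤ derivWithin ψ' U 0 := hmono.derivWithin_nonneg
  rw [hψ'deriv.hasDerivWithinAt.derivWithin (hUopen.uniqueDiffWithinAt h0)] at h4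
  linarith

/-! ### Regularity and log-concavity of the tail integral -/

/-- The derivative in the endpoint is `-f`, so one order of smoothness is gained. -/
lemma contDiff_integral_Ioi {f : ℝ → ℝ} (hf : ContDiff ℝ 1 f) (hint : Integrable f) :
    ContDiff ℝ 2 fun t => ∫ y in Ioi t, f y := by
  have h1 : ∀ t, HasDerivAt (fun t => ∫ y in Ioi t, f y) (-f t) t := by
    intro t
    have h2 : (fun t => ∫ y in Ioi t, f y) =
        fun t => (∫ y in Ioi (0 : ℝ), f y) - ∫ y in (0 : ℝ)..t, f y := by
      funext t
      rw [eq_sub_iff_add_eq, add_comm]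
      exact intervalIntegral.integral_interval_add_Ioi hint.integrableOn hint.integrableOn
    rw [h2]
    exact (hf.continuous.integral_hasStrictDerivAt 0 t).hasDerivAt.const_sub _
  rw [show (2 : WithTop ℕ∞) = 1 + 1 by norm_num, contDiff_succ_iff_deriv]
  refine ⟨fun t => (h1 t).differentiableAt, by simp, ?_⟩
  rw [funext fun t => (h1 t).deriv]
  exact hf.neg

/-- The integral of `w y * ∏ i, (y - x i)` over the `y` that exceed the largest coordinate. -/
def tailIntegral {m : ℕ} (w : ℝ → ℝ) (x : Fin (m + 1) → ℝ) : ℝ :=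
  ∫ y in Ioi (x (Fin.last m)), w y * ∏ i, (y - x i)

/-- Expanding the product moves `x` into polynomial coefficients. After integration, `x` remains in
the integrals only through the endpoint, so no differentiation under the integral sign is needed. -/
lemma mul_prod_sub_eq_sum {m : ℕ} (w : ℝ → ℝ) (x : Fin (m + 1) → ℝ) (y : ℝ) :
    w y * ∏ i, (y - x i) = ∑ s ∈ (Finset.univ : Finset (Fin (m + 1))).powerset,
      (∏ i ∈ Finset.univ \ s, -x i) * (y ^ s.card * w y) := by
  simp_rw [sub_eq_add_neg, Finset.prod_add, Finset.mul_sum, Finset.prod_const]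
  exact Finset.sum_congr rfl fun s _ => by ring

lemma integrable_mul_prod_sub {m : ℕ} {w : ℝ → ℝ} (hint : ∀ k : ℕ, Integrable fun y => y ^ k * w y)
    (x : Fin (m + 1) → ℝ) : Integrable fun y => w y * ∏ i, (y - x i) := by
  simp_rw [mul_prod_sub_eq_sum]
  exact integrable_finsetSum _ fun s _ => (hint _).const_mul _

lemma contDiff_tailIntegral {m : ℕ} {w : ℝ → ℝ} (hw : ContDiff ℝ 1 w)
    (hint : ∀ k : ℕ, Integrable fun y => y ^ k * w y) :
    ContDiff ℝ 2 (tailIntegral (m := m) w) := by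
  have h : tailIntegral (m := m) w = fun x =>
      ∑ s ∈ (Finset.univ : Finset (Fin (m + 1))).powerset,
        (∏ i ∈ Finset.univ \ s, -x i) * ∫ y in Ioi (x (Fin.last m)), y ^ s.card * w y := by
    funext x
    unfold tailIntegral
    simp_rw [mul_prod_sub_eq_sum]
    rw [integral_finsetSum _ fun s _ => ((hint _).const_mul _).integrableOn]
    simp_rw [integral_const_mul]
  rw [h]
  refine ContDiff.sum fun s _ => ContDiff.mul (contDiff_prod fun i _ => (contDiff_apply ℝ ℝ i).neg) ?_
  exact (contDiff_integral_Ioi ((contDiff_id.pow _).mul hw) (hint s.card)).comp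
    (contDiff_apply ℝ ℝ (Fin.last m))

lemma le_last_of_mem_ordered {m : ℕ} {x : Fin (m + 1) → ℝ} (hx : x ∈ ordered (m + 1))
    (i : Fin (m + 1)) : x i ≤ x (Fin.last m) :=
  StrictMono.monotone hx (Fin.le_last i)

lemma tailIntegral_pos {m : ℕ} {w : ℝ → ℝ} (hw : ∀ y, 0 < w y)
    (hint : ∀ k : ℕ, Integrable fun y => y ^ k * w y) {x : Fin (m + 1) → ℝ}
    (hx : x ∈ ordered (m + 1)) : 0 < tailIntegral w x := by
  refine integral_Ioi_pos (fun y hy => ?_) (integrable_mul_prod_sub hint x).integrableOn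
  exact mul_pos (hw y) (Finset.prod_pos fun i _ => by linarith [le_last_of_mem_ordered hx i])

/-- The shift makes the domain independent of `x`, as Prékopa–Leindler requires. -/
lemma tailIntegral_eq_integral_Ioi_zero {m : ℕ} (w : ℝ → ℝ) (x : Fin (m + 1) → ℝ) :
    tailIntegral w x =
      ∫ u in Ioi 0, w (u + x (Fin.last m)) * ∏ i, (u + x (Fin.last m) - x i) := by
  have h := (measurePreserving_add_right volume (x (Fin.last m))).setIntegral_preimage_emb
    (measurableEmbedding_addRight _) (fun y => w y * ∏ i, (y - x i)) (Ioi (x (Fin.last m)))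
  rw [tailIntegral, ← h]
  simp

/-- Integrating out the largest coordinate preserves log-concavity. -/
theorem tailIntegral_rpow_mul_rpow_le {m : ℕ} {w : ℝ → ℝ} (hcont : Continuous w)
    (hw : ∀ y, 0 < w y) (hint : ∀ k : ℕ, Integrable fun y => y ^ k * w y) {a b : ℝ} (ha : 0 < a)
    (hb : 0 < b) (hab : a + b = 1) (hlog : ∀ y z, w y ^ a * w z ^ b ≤ w (a * y + b * z))
    {x x' : Fin (m + 1) → ℝ} (hx : x ∈ ordered (m + 1)) (hx' : x' ∈ ordered (m + 1)) :
    tailIntegral w x ^ a * tailIntegral w x' ^ b ≤ tailIntegral w (a • x + b • x') := by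
  have hpos : ∀ x ∈ ordered (m + 1), ∀ u : ℝ, 0 < u → ∀ i, 0 < u + x (Fin.last m) - x i :=
    fun x hx u hu i => by linarith [le_last_of_mem_ordered hx i]
  have hposF : ∀ x ∈ ordered (m + 1), ∀ u : ℝ, 0 < u →
      0 < w (u + x (Fin.last m)) * ∏ i, (u + x (Fin.last m) - x i) :=
    fun x hx u hu => mul_pos (hw _) (Finset.prod_pos fun i _ => hpos x hx u hu i)
  have hcontF : ∀ x : Fin (m + 1) → ℝ,
      Continuous fun u => w (u + x (Fin.last m)) * ∏ i, (u + x (Fin.last m) - x i) :=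
    fun x => by fun_prop
  have hintF : ∀ x : Fin (m + 1) → ℝ, Integrable fun u =>
      w (u + x (Fin.last m)) * ∏ i, (u + x (Fin.last m) - x i) :=
    fun x => (integrable_mul_prod_sub hint x).comp_add_right (x (Fin.last m))
  have hmem : a • x + b • x' ∈ ordered (m + 1) := convex_ordered _ hx hx' ha.le hb.le hab
  simp_rw [tailIntegral_eq_integral_Ioi_zero]
  refine prekopa_leindler_Ioi ha hb hab (hcontF x) (hcontF x') (hposF x hx) (hposF x' hx')
    (hintF x).integrableOn (hintF x').integrableOn (hintF _).integrableOn
    (fun u hu => (hposF _ hmem u hu).le) fun u u' hu hu' => ?_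
  have h1 := fun i => (hpos x hx u hu i).le
  have h2 := fun i => (hpos x' hx' u' hu' i).le
  rw [Real.mul_rpow (hw _).le (Finset.prod_nonneg fun i _ => h1 i),
    Real.mul_rpow (hw _).le (Finset.prod_nonneg fun i _ => h2 i),
    ← Real.finsetProd_rpow _ _ fun i _ => h1 i, ← Real.finsetProd_rpow _ _ fun i _ => h2 i,
    mul_mul_mul_comm, ← Finset.prod_mul_distrib]
  have hnn : ∀ i, 0 ≤ (u + x (Fin.last m) - x i) ^ a * (u' + x' (Fin.last m) - x' i) ^ b :=
    fun i => mul_nonneg (Real.rpow_nonneg (h1 i) _) (Real.rpow_nonneg (h2 i) _)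
  -- AM–GM is applied factor by factor; `u + x (Fin.last m) - x i` is linear in `(u, x)`, so the
  -- arithmetic means are exactly the factors at the combined point.
  refine mul_le_mul ((hlog _ _).trans_eq ?_) (Finset.prod_le_prod (fun i _ => hnn i) fun i _ => ?_)
    (Finset.prod_nonneg fun i _ => hnn i) (hw _).le
  · congr 1
    simp only [Pi.add_apply, Pi.smul_apply, smul_eq_mul]
    ring
  · refine (Real.geom_mean_le_arith_mean2_weighted ha.le hb.le (h1 i) (h2 i) hab).trans_eq ?_
    simp only [Pi.add_apply, Pi.smul_apply, smul_eq_mul]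
    ring

lemma concaveOn_log_tailIntegral {m : ℕ} {w : ℝ → ℝ} (hcont : Continuous w)
    (hw : ∀ y, 0 < w y) (hint : ∀ k : ℕ, Integrable fun y => y ^ k * w y)
    (hlog : ∀ a b : ℝ, 0 < a → 0 < b → a + b = 1 →
      ∀ y z, w y ^ a * w z ^ b ≤ w (a * y + b * z)) :
    ConcaveOn ℝ (ordered (m + 1)) fun x => Real.log (tailIntegral w x) := by
  refine concaveOn_iff_forall_pos.2 ⟨convex_ordered _, fun x hx x' hx' a b ha hb hab => ?_⟩
  have h1 := tailIntegral_pos hw hint hx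
  have h2 := tailIntegral_pos hw hint hx'
  rw [smul_eq_mul, smul_eq_mul, ← Real.log_rpow h1, ← Real.log_rpow h2,
    ← Real.log_mul (Real.rpow_pos_of_pos h1 _).ne' (Real.rpow_pos_of_pos h2 _).ne']
  exact Real.log_le_log (mul_pos (Real.rpow_pos_of_pos h1 _) (Real.rpow_pos_of_pos h2 _))
    (tailIntegral_rpow_mul_rpow_le hcont hw hint ha hb hab (hlog a b ha hb hab) hx hx')

/-! ### Gaussian integrability -/

/-- This majorant serves both the moments of the single-particle weight and the coordinate factors
that dominate the full density. -/
lemma integrable_one_add_abs_pow_mul_exp {b : ℝ} (hb : 0 < b) (k : ℕ) :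
    Integrable fun y : ℝ => (1 + |y|) ^ k * Real.exp (-b * y ^ 2) := by
  have h : ∀ j : ℕ, Integrable fun y : ℝ => |y| ^ j * Real.exp (-b * y ^ 2) := by
    intro j
    have := (integrable_rpow_mul_exp_neg_mul_sq hb (s := (j : ℝ))
      (by have : (0 : ℝ) ≤ j := j.cast_nonneg
          linarith)).abs
    simpa [abs_mul, abs_pow] using this
  simp_rw [add_comm (1 : ℝ), add_pow, one_pow, mul_one, Finset.sum_mul]
  refine integrable_finsetSum _ fun j _ => ?_
  refine ((h j).const_mul (k.choose j : ℝ)).congr (ae_of_all _ fun y => ?_)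
  ring

/-- The Gaussian weight of a single particle with confinement of strength `c` around `γ`. -/
def gaussianWeight (N c γ : ℝ) (y : ℝ) : ℝ :=
  Real.exp (-N * ((1 / 4 : ℝ) * y ^ 2 + c * (y - γ) ^ 2))

lemma gaussianWeight_pos (N c γ y : ℝ) : 0 < gaussianWeight N c γ y := Real.exp_pos _

lemma contDiff_gaussianWeight (N c γ : ℝ) {n : WithTop ℕ∞} : ContDiff ℝ n (gaussianWeight N c γ) := by
  unfold gaussianWeight
  fun_prop

lemma integrable_pow_mul_gaussianWeight {N c : ℝ} (hN : 0 < N) (hc : 0 ≤ c) (γ : ℝ) (k : ℕ) :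
    Integrable fun y => y ^ k * gaussianWeight N c γ y := by
  refine (integrable_one_add_abs_pow_mul_exp (b := N / 4) (by positivity) k).mono'
    (by unfold gaussianWeight; fun_prop) (ae_of_all _ fun y => ?_)
  rw [norm_mul, norm_pow, Real.norm_eq_abs, Real.norm_of_nonneg (gaussianWeight_pos _ _ _ _).le]
  refine mul_le_mul (pow_le_pow_left₀ (abs_nonneg y) (by linarith) k) (Real.exp_le_exp.2 ?_)
    (Real.exp_pos _).le (by positivity)
  have : 0 ≤ N * (c * (y - γ) ^ 2) := by positivity
  linarith

lemma gaussianWeight_rpow_mul_rpow_le {N c : ℝ} (hN : 0 ≤ N) (hc : 0 ≤ c) (γ : ℝ) {a b : ℝ}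
    (ha : 0 < a) (hb : 0 < b) (hab : a + b = 1) (y z : ℝ) :
    gaussianWeight N c γ y ^ a * gaussianWeight N c γ z ^ b ≤
      gaussianWeight N c γ (a * y + b * z) := by
  unfold gaussianWeight
  rw [← Real.exp_mul, ← Real.exp_mul, ← Real.exp_add, Real.exp_le_exp]
  obtain rfl : b = 1 - a := by linarith
  -- This is the exact difference of the two exponents.
  have : 0 ≤ N * (1 / 4 + c) * (a * (1 - a)) * (y - z) ^ 2 := by positivity
  linarith [this]

/-! ### Splitting off the largest particle -/

/-- With the range independent of `i`, both sums can be split at the last index. -/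
lemma logSum_eq_sum_ite {n : ℕ} (x : Fin n → ℝ) :
    logSum x = ∑ i, ∑ j, if i < j then Real.log |x i - x j| else 0 := by
  unfold logSum
  refine Finset.sum_congr rfl fun i _ => ?_
  rw [← Finset.sum_filter]
  congr 1
  ext j
  simp

lemma logSum_snoc {n : ℕ} (x : Fin n → ℝ) (y : ℝ) :
    logSum (Fin.snoc (α := fun _ => ℝ) x y) = logSum x + ∑ i, Real.log |x i - y| := by
  simp only [logSum_eq_sum_ite, Fin.sum_univ_castSucc, Fin.snoc_castSucc, Fin.snoc_last,
    Fin.castSucc_lt_castSucc_iff, Fin.castSucc_lt_last, if_true, Finset.sum_add_distrib]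
  simp [not_lt.2 (Fin.le_last _)]

/-- The strength of the confining potential. -/
def confinementStrength (m : ℕ) (ρ ε : ℝ) : ℝ := 1 / (2 * scaleR (m + 2) ρ ε ^ 2)

lemma confinementStrength_nonneg (m : ℕ) (ρ ε : ℝ) : 0 ≤ confinementStrength m ρ ε := by
  unfold confinementStrength
  positivity

/-- The weight of the largest particle under the pseudo-equilibrium measure. -/
def lastWeight (m : ℕ) (ρ ε σ : ℝ) : ℝ → ℝ :=
  gaussianWeight ((m + 2 : ℕ) : ℝ) (confinementStrength m ρ ε)
    (gammaLoc (m + 2) σ (Fin.last (m + 1)))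

/-- The quadratic potential of the particles other than the largest one. -/
def quadHat (m : ℕ) (ρ ε σ : ℝ) (x : Fin (m + 1) → ℝ) : ℝ :=
  ∑ i, ((1 / 4 : ℝ) * x i ^ 2 +
    confinementStrength m ρ ε * (x i - gammaLoc (m + 2) σ (Fin.castSucc i)) ^ 2)

/-- The effective potential of the particles other than the largest one. -/
def potentialHat (m : ℕ) (ρ ε σ : ℝ) (x : Fin (m + 1) → ℝ) : ℝ :=
  quadHat m ρ ε σ x - 1 / ((m + 2 : ℕ) : ℝ) * Real.log (tailIntegral (lastWeight m ρ ε σ) x)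

lemma integrable_pow_mul_lastWeight (m : ℕ) (ρ ε σ : ℝ) (k : ℕ) :
    Integrable fun y => y ^ k * lastWeight m ρ ε σ y :=
  integrable_pow_mul_gaussianWeight (by positivity) (confinementStrength_nonneg _ _ _) _ k

lemma tailIntegral_lastWeight_pos {m : ℕ} (ρ ε σ : ℝ) {x : Fin (m + 1) → ℝ}
    (hx : x ∈ ordered (m + 1)) : 0 < tailIntegral (lastWeight m ρ ε σ) x :=
  tailIntegral_pos (gaussianWeight_pos _ _ _) (integrable_pow_mul_lastWeight m ρ ε σ) hx

lemma contDiffOn_potentialHat (m : ℕ) (ρ ε σ : ℝ) :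
    ContDiffOn ℝ 2 (potentialHat m ρ ε σ) (ordered (m + 1)) := by
  have h1 : ContDiff ℝ 2 (quadHat m ρ ε σ) := by
    unfold quadHat
    fun_prop
  have h2 : ContDiff ℝ 2 (tailIntegral (m := m) (lastWeight m ρ ε σ)) :=
    contDiff_tailIntegral (contDiff_gaussianWeight _ _ _) (integrable_pow_mul_lastWeight m ρ ε σ)
  exact h1.contDiffOn.sub (contDiffOn_const.mul
    (h2.contDiffOn.log fun x hx => (tailIntegral_lastWeight_pos ρ ε σ hx).ne'))

lemma convexOn_sum_sq_add {n : ℕ} (p r : Fin n → ℝ) {s : Set (Fin n → ℝ)} (hs : Convex ℝ s) :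
    ConvexOn ℝ s fun x => ∑ i, ((1 / 4 : ℝ) * x i ^ 2 + p i * x i + r i) := by
  refine ⟨hs, fun x _ y _ a b ha hb hab => ?_⟩
  simp only [smul_eq_mul, Finset.mul_sum, ← Finset.sum_add_distrib, Pi.add_apply, Pi.smul_apply]
  refine Finset.sum_le_sum fun i _ => ?_
  obtain rfl : b = 1 - a := by linarith
  have : 0 ≤ a * (1 - a) * (x i - y i) ^ 2 := by positivity
  linarith

/-- Since the confinement strength is `1 / (2 * R ^ 2)`, the subtraction cancels its squares and
leaves `x i ^ 2 / 4` plus affine terms. The remaining term is `-1 / N` times a concave logarithm. -/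
lemma convexOn_potentialHat_sub (m : ℕ) (ρ ε σ : ℝ) :
    ConvexOn ℝ (ordered (m + 1)) fun x => potentialHat m ρ ε σ x -
      (scaleR (m + 2) ρ ε ^ 2)⁻¹ / 2 * ∑ i, x i ^ 2 := by
  set c := confinementStrength m ρ ε with hc
  have h1 := convexOn_sum_sq_add
    (fun i : Fin (m + 1) => -(2 * c * gammaLoc (m + 2) σ (Fin.castSucc i)))
    (fun i => c * gammaLoc (m + 2) σ (Fin.castSucc i) ^ 2) (convex_ordered (m + 1))
  have h2 : ConcaveOn ℝ (ordered (m + 1)) fun x =>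
      Real.log (tailIntegral (lastWeight m ρ ε σ) x) :=
    concaveOn_log_tailIntegral (contDiff_gaussianWeight (n := 0) _ _ _).continuous
      (gaussianWeight_pos _ _ _) (integrable_pow_mul_lastWeight m ρ ε σ)
      fun a b ha hb hab => gaussianWeight_rpow_mul_rpow_le (by positivity)
        (confinementStrength_nonneg _ _ _) _ ha hb hab
  refine (h1.sub (h2.smul (show (0 : ℝ) ≤ 1 / ((m + 2 : ℕ) : ℝ) by positivity))).congr fun x _ => ?_
  have h3 : (scaleR (m + 2) ρ ε ^ 2)⁻¹ / 2 = c := by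
    rw [hc, confinementStrength, one_div, mul_inv]
    ring
  rw [h3]
  simp only [potentialHat, quadHat, Pi.sub_apply, smul_eq_mul, ← hc]
  rw [sub_right_comm, Finset.mul_sum, ← Finset.sum_sub_distrib]
  congr 1
  exact Finset.sum_congr rfl fun i _ => by ring

lemma hamiltonian_add_confinement_snoc (m : ℕ) (ρ ε σ : ℝ) {x : Fin (m + 1) → ℝ}
    (hx : x ∈ ordered (m + 1)) {y : ℝ} (hy : x (Fin.last m) < y) :
    Real.exp (-((m + 2 : ℕ) : ℝ) * hamiltonian (m + 2) (Fin.snoc (α := fun _ => ℝ) x y) -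
      ((m + 2 : ℕ) : ℝ) * confinement (m + 2) ρ ε σ (Fin.snoc (α := fun _ => ℝ) x y)) =
    Real.exp (logSum x - ((m + 2 : ℕ) : ℝ) * quadHat m ρ ε σ x) *
      (lastWeight m ρ ε σ y * ∏ i, (y - x i)) := by
  have hpos : ∀ i, 0 < y - x i := fun i => by linarith [le_last_of_mem_ordered hx i]
  have h1 : ∏ i, (y - x i) = Real.exp (∑ i, Real.log |x i - y|) := by
    rw [Real.exp_sum]
    refine Finset.prod_congr rfl fun i _ => ?_
    rw [abs_sub_comm, abs_of_pos (hpos i), Real.exp_log (hpos i)]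
  have hN : ((m + 2 : ℕ) : ℝ) * (1 / ((m + 2 : ℕ) : ℝ)) = 1 := mul_one_div_cancel (by positivity)
  rw [h1, lastWeight, gaussianWeight, ← Real.exp_add, ← Real.exp_add, Real.exp_eq_exp, hamiltonian,
    confinement, logSum_snoc, quadHat, Finset.sum_add_distrib]
  simp only [Fin.sum_univ_castSucc, Fin.snoc_castSucc, Fin.snoc_last,
    confinementStrength]
  linear_combination
    (logSum x + (∑ i : Fin m, Real.log |x i.castSucc - y| + Real.log |x (Fin.last m) - y|)) * hN

/-! ### Integrability of the densities -/

lemma log_abs_sub_le (a b : ℝ) :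
    Real.log |a - b| ≤ Real.log (1 + |a|) + Real.log (1 + |b|) := by
  have ha := abs_nonneg a
  have hb := abs_nonneg b
  rw [← Real.log_mul (by positivity) (by positivity)]
  -- On the diagonal the convention `Real.log 0 = 0` makes the bound hold.
  rcases eq_or_ne a b with rfl | h
  · simpa using Real.log_nonneg (by nlinarith : (1 : ℝ) ≤ (1 + |a|) * (1 + |a|))
  · refine Real.log_le_log (abs_pos.2 (sub_ne_zero.2 h)) ((abs_sub a b).trans ?_)
    nlinarith [mul_nonneg ha hb]

/-- Crude, but it decouples the coordinates: the exponential of the right side is a product of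
polynomial factors, which the Gaussians absorb. -/
lemma logSum_le {n : ℕ} (x : Fin n → ℝ) :
    logSum x ≤ ∑ i, ((2 * n : ℕ) : ℝ) * Real.log (1 + |x i|) := by
  have hnn : ∀ i, 0 ≤ Real.log (1 + |x i|) := fun i =>
    Real.log_nonneg (by linarith [abs_nonneg (x i)])
  calc logSum x
      ≤ ∑ i, ∑ j ∈ Finset.Ioi i, (Real.log (1 + |x i|) + Real.log (1 + |x j|)) :=
        Finset.sum_le_sum fun i _ => Finset.sum_le_sum fun j _ => log_abs_sub_le _ _
    _ ≤ ∑ i, ∑ j, (Real.log (1 + |x i|) + Real.log (1 + |x j|)) :=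
        Finset.sum_le_sum fun i _ => Finset.sum_le_sum_of_subset_of_nonneg (Finset.subset_univ _)
          fun j _ _ => add_nonneg (hnn i) (hnn j)
    _ = ∑ i, ((2 * n : ℕ) : ℝ) * Real.log (1 + |x i|) := by
        simp only [Finset.sum_add_distrib, Finset.sum_const, Finset.card_univ, Fintype.card_fin,
          nsmul_eq_mul, ← Finset.mul_sum]
        push_cast
        ring

lemma measurable_hamiltonian (N : ℕ) : Measurable (hamiltonian N) := by
  unfold hamiltonian logSum
  fun_prop

lemma measurable_confinement (N : ℕ) (ρ ε σ : ℝ) : Measurable (confinement N ρ ε σ) := by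
  unfold confinement
  fun_prop

lemma integrable_exp_neg_hamiltonian {N : ℕ} (hN : N ≠ 0) :
    Integrable fun x => Real.exp (-(N : ℝ) * hamiltonian N x) := by
  have hN0 : 0 < (N : ℝ) := by positivity
  have h : Integrable fun x : Fin N → ℝ =>
      ∏ i, ((1 + |x i|) ^ (2 * N) * Real.exp (-((N : ℝ) / 4) * x i ^ 2)) :=
    Integrable.fintype_prod
      (f := fun _ (y : ℝ) => (1 + |y|) ^ (2 * N) * Real.exp (-((N : ℝ) / 4) * y ^ 2))
      fun _ => integrable_one_add_abs_pow_mul_exp (by positivity) _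
  refine h.mono' (by have := measurable_hamiltonian N; fun_prop) (ae_of_all _ fun x => ?_)
  rw [Real.norm_of_nonneg (Real.exp_pos _).le]
  have h1 : ∀ i, (1 + |x i|) ^ (2 * N) * Real.exp (-((N : ℝ) / 4) * x i ^ 2) =
      Real.exp (((2 * N : ℕ) : ℝ) * Real.log (1 + |x i|) - (N : ℝ) * ((1 / 4 : ℝ) * x i ^ 2)) := by
    intro i
    have : 0 < 1 + |x i| := by positivity
    rw [sub_eq_add_neg, Real.exp_add, Real.exp_nat_mul, Real.exp_log this]
    congr 2
    ring
  simp_rw [h1]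
  rw [← Real.exp_sum, Real.exp_le_exp, hamiltonian, Finset.sum_sub_distrib, ← Finset.mul_sum (a := (N : ℝ))]
  have h2 : (N : ℝ) * (1 / N) = 1 := mul_one_div_cancel hN0.ne'
  linear_combination logSum_le x + logSum x * h2

lemma integrable_exp_neg_hamiltonian_sub {N : ℕ} (hN : N ≠ 0) (ρ ε σ : ℝ) :
    Integrable fun x =>
      Real.exp (-(N : ℝ) * hamiltonian N x - (N : ℝ) * confinement N ρ ε σ x) := by
  refine (integrable_exp_neg_hamiltonian hN).mono'
    (by
      have := measurable_hamiltonian N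
      have := measurable_confinement N ρ ε σ
      fun_prop) (ae_of_all _ fun x => ?_)
  rw [Real.norm_of_nonneg (Real.exp_pos _).le, Real.exp_le_exp]
  have : 0 ≤ (N : ℝ) * confinement N ρ ε σ x := by
    unfold confinement
    positivity
  linarith

lemma setIntegral_ordered_pos {n : ℕ} {f : (Fin n → ℝ) → ℝ} (hf : ∀ x, 0 < f x)
    (hint : Integrable f) : 0 < ∫ x in ordered n, f x := by
  rw [setIntegral_pos_iff_support_of_nonneg_ae (ae_of_all _ fun x => (hf x).le) hint.integrableOn,
    Function.support_eq_univ fun x => (hf x).ne', univ_inter]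
  exact (isOpen_ordered n).measure_pos _ ⟨fun i => (i : ℝ), fun i j hij => by simpa using hij⟩

lemma partitionZ_pos {N : ℕ} (hN : N ≠ 0) : 0 < partitionZ N :=
  setIntegral_ordered_pos (fun _ => Real.exp_pos _) (integrable_exp_neg_hamiltonian hN)

lemma partitionZtilde_pos {N : ℕ} (hN : N ≠ 0) (ρ ε σ : ℝ) : 0 < partitionZtilde N ρ ε σ :=
  setIntegral_ordered_pos (fun _ => Real.exp_pos _) (integrable_exp_neg_hamiltonian_sub hN ρ ε σ)

lemma measurable_omegaDensity (N : ℕ) (ρ ε σ : ℝ) : Measurable (omegaDensity N ρ ε σ) := by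
  have := measurable_hamiltonian N
  have := measurable_confinement N ρ ε σ
  unfold omegaDensity
  fun_prop

lemma omegaDensity_nonneg {N : ℕ} (hN : N ≠ 0) (ρ ε σ : ℝ) (x : Fin N → ℝ) :
    0 ≤ omegaDensity N ρ ε σ x :=
  mul_nonneg (inv_nonneg.2 (partitionZtilde_pos hN ρ ε σ).le) (Real.exp_pos _).le

/-- The densities multiply, and the factor `partitionZ N` cancels because it is nonzero. -/
lemma omega_eq_withDensity {N : ℕ} (hN : N ≠ 0) (ρ ε σ : ℝ) :
    omega N ρ ε σ = (volume.restrict (ordered N)).withDensity fun x =>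
      ENNReal.ofReal (omegaDensity N ρ ε σ x) := by
  have h1 := measurable_hamiltonian N
  have h2 := measurable_confinement N ρ ε σ
  rw [omega, equilibriumMeasure, ← withDensity_mul _ (by fun_prop) (by unfold psi; fun_prop)]
  congr 1
  funext x
  have hZ := (partitionZ_pos hN).ne'
  rw [Pi.mul_apply, ← ENNReal.ofReal_mul
    (mul_nonneg (inv_nonneg.2 (partitionZ_pos hN).le) (Real.exp_pos _).le), psi, omegaDensity,
    sub_eq_add_neg, Real.exp_add, ← neg_mul]
  congr 1
  field_simp

theorem isProbabilityMeasure_omega {N : ℕ} (hN : N ≠ 0) (ρ ε σ : ℝ) :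
    IsProbabilityMeasure (omega N ρ ε σ) := by
  refine ⟨?_⟩
  rw [omega_eq_withDensity hN, withDensity_apply _ MeasurableSet.univ, Measure.restrict_univ,
    ← ofReal_integral_eq_lintegral_ofReal (f := omegaDensity N ρ ε σ)
      ((integrable_exp_neg_hamiltonian_sub hN ρ ε σ).integrableOn.const_mul _)
      (ae_of_all _ fun x => omegaDensity_nonneg hN ρ ε σ x)]
  simp only [omegaDensity]
  rw [integral_const_mul, ← partitionZtilde, inv_mul_cancel₀ (partitionZtilde_pos hN ρ ε σ).ne',
    ENNReal.ofReal_one]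

/-! ### The marginal -/

/-- Given an ordered `x`, the order constrains the new particle only through its left neighbour;
this produces the half-line domain of the marginal. -/
lemma snoc_mem_ordered_iff {n : ℕ} (x : Fin (n + 1) → ℝ) (y : ℝ) :
    Fin.snoc (α := fun _ => ℝ) x y ∈ ordered (n + 2) ↔ x ∈ ordered (n + 1) ∧ x (Fin.last n) < y := by
  constructor
  · intro h
    refine ⟨fun i j hij => ?_, ?_⟩
    · simpa using h (Fin.castSucc_lt_castSucc_iff.2 hij)
    · simpa using h (Fin.castSucc_lt_last (Fin.last n))
  · rintro ⟨hx, hy⟩ i j hij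
    induction j using Fin.lastCases with
    | last =>
      induction i using Fin.lastCases with
      | last => exact absurd hij (lt_irrefl _)
      | cast i => simpa using (le_last_of_mem_ordered hx i).trans_lt hy
    | cast j =>
      induction i using Fin.lastCases with
      | last => exact absurd hij (Fin.castSucc_lt_last j).not_gt
      | cast i => simpa using hx (Fin.castSucc_lt_castSucc_iff.1 hij)

lemma lintegral_eq_lintegral_lintegral_snoc {n : ℕ} {f : (Fin (n + 1) → ℝ) → ENNReal}
    (hf : Measurable f) :
    ∫⁻ x, f x = ∫⁻ x : Fin n → ℝ, ∫⁻ y : ℝ, f (Fin.snoc (α := fun _ => ℝ) x y) := by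
  have h := (volume_preserving_piFinSuccAbove (fun _ : Fin (n + 1) => ℝ) (Fin.last n)).symm
  rw [← h.lintegral_comp hf, Measure.volume_eq_prod,
    lintegral_prod_symm _ (by fun_prop)]
  refine lintegral_congr fun x => lintegral_congr fun y => congrArg f ?_
  exact Fin.insertNth_last' y x

lemma omegaDensity_snoc (m : ℕ) (ρ ε σ : ℝ) {x : Fin (m + 1) → ℝ}
    (hx : x ∈ ordered (m + 1)) {y : ℝ} (hy : x (Fin.last m) < y) :
    omegaDensity (m + 2) ρ ε σ (Fin.snoc (α := fun _ => ℝ) x y) =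
      (partitionZtilde (m + 2) ρ ε σ)⁻¹ *
        (Real.exp (logSum x - ((m + 2 : ℕ) : ℝ) * quadHat m ρ ε σ x) *
          (lastWeight m ρ ε σ y * ∏ i, (y - x i))) := by
  rw [omegaDensity, hamiltonian_add_confinement_snoc m ρ ε σ hx hy]

lemma omegaHatDensity_eq (m : ℕ) (ρ ε σ : ℝ) {x : Fin (m + 1) → ℝ} (hx : x ∈ ordered (m + 1)) :
    omegaHatDensity m ρ ε σ x = (partitionZtilde (m + 2) ρ ε σ)⁻¹ *
      Real.exp (-((m + 2 : ℕ) : ℝ) * hamiltonianHat m (potentialHat m ρ ε σ) x) := by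
  have hN : ((m + 2 : ℕ) : ℝ) * (1 / ((m + 2 : ℕ) : ℝ)) = 1 := mul_one_div_cancel (by positivity)
  rw [omegaHatDensity, setIntegral_congr_fun measurableSet_Ioi
    fun y hy => omegaDensity_snoc m ρ ε σ hx hy, integral_const_mul, integral_const_mul,
    ← tailIntegral]
  congr 1
  -- Positivity of the tail integral lets it be absorbed into the exponent.
  rw [← Real.exp_log (tailIntegral_lastWeight_pos ρ ε σ hx), ← Real.exp_add, Real.exp_eq_exp, hamiltonianHat, potentialHat]
  linear_combination -(logSum x + Real.log (tailIntegral (lastWeight m ρ ε σ) x)) * hN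

lemma lintegral_omegaDensity_snoc (m : ℕ) (ρ ε σ : ℝ) {x : Fin (m + 1) → ℝ}
    (hx : x ∈ ordered (m + 1)) :
    ∫⁻ y in Ioi (x (Fin.last m)),
        ENNReal.ofReal (omegaDensity (m + 2) ρ ε σ (Fin.snoc (α := fun _ => ℝ) x y)) =
      ENNReal.ofReal (omegaHatDensity m ρ ε σ x) := by
  refine (ofReal_integral_eq_lintegral_ofReal ?_
    (ae_of_all _ fun y => omegaDensity_nonneg (by omega) ρ ε σ _)).symm
  -- Integrability in the last variable is read off from the factorized form, valid on the half
  -- line.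
  refine IntegrableOn.congr_fun ?_
    (fun y hy => (omegaDensity_snoc m ρ ε σ hx hy).symm) measurableSet_Ioi
  exact (((integrable_mul_prod_sub (integrable_pow_mul_lastWeight m ρ ε σ) x).const_mul _).const_mul
    _).integrableOn

theorem omegaHat_eq_withDensity (m : ℕ) (ρ ε σ : ℝ) :
    omegaHat m ρ ε σ = (volume.restrict (ordered (m + 1))).withDensity fun x =>
      ENNReal.ofReal (omegaHatDensity m ρ ε σ x) := by
  have hmeas : ∀ n, MeasurableSet (ordered n) := fun n => (isOpen_ordered n).measurableSet
  have hπ : Measurable fun (x : Fin (m + 2) → ℝ) (i : Fin (m + 1)) => x (Fin.castSucc i) := by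
    fun_prop
  have hd : Measurable fun x => ENNReal.ofReal (omegaDensity (m + 2) ρ ε σ x) :=
    (measurable_omegaDensity (m + 2) ρ ε σ).ennreal_ofReal
  ext A hA
  rw [omegaHat, Measure.map_apply hπ hA, omega_eq_withDensity (by omega),
    withDensity_apply _ (hπ hA), withDensity_apply _ hA, Measure.restrict_restrict (hπ hA),
    Measure.restrict_restrict hA, ← lintegral_indicator ((hπ hA).inter (hmeas _)),
    ← lintegral_indicator (hA.inter (hmeas _)),
    lintegral_eq_lintegral_lintegral_snoc (hd.indicator ((hπ hA).inter (hmeas _)))]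
  refine lintegral_congr fun x => ?_
  -- For `x` in the set the fibre is exactly the half line above the last coordinate; otherwise it
  -- is empty.
  by_cases hx : x ∈ A ∩ ordered (m + 1)
  · rw [indicator_of_mem hx, ← lintegral_omegaDensity_snoc m ρ ε σ hx.2,
      ← lintegral_indicator measurableSet_Ioi]
    refine lintegral_congr fun y => ?_
    simp only [indicator, mem_inter_iff, mem_preimage, Fin.snoc_castSucc, snoc_mem_ordered_iff, hx.1,
      hx.2, true_and, mem_Ioi]
  · rw [indicator_of_notMem hx]
    refine (lintegral_congr fun y => indicator_of_notMem (fun h => hx ?_) _).trans lintegral_zero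
    simp only [mem_inter_iff, mem_preimage, Fin.snoc_castSucc, snoc_mem_ordered_iff] at h
    exact ⟨h.1, h.2.1⟩

end PseudoEquilibrium

end

theorem mainTheorem11 (m : ℕ) (ρ ε σ : ℝ) (hρ0 : 0 < ρ) (hρ1 : ρ < 1) (hε : 0 < ε) (hσ : 0 < σ) :
    MeasureTheory.IsProbabilityMeasure (PseudoEquilibrium.omega (m + 2) ρ ε σ) ∧
    ∃ V : (Fin (m + 1) → ℝ) → ℝ,
      ContDiffOn ℝ 2 V (PseudoEquilibrium.ordered (m + 1)) ∧
      (∀ xhat ∈ PseudoEquilibrium.ordered (m + 1),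
        PseudoEquilibrium.omegaHatDensity m ρ ε σ xhat =
          (PseudoEquilibrium.partitionZtilde (m + 2) ρ ε σ)⁻¹ *
            Real.exp (-((m + 2 : ℕ) : ℝ) * PseudoEquilibrium.hamiltonianHat m V xhat)) ∧
      PseudoEquilibrium.omegaHat m ρ ε σ =
        (MeasureTheory.volume.restrict (PseudoEquilibrium.ordered (m + 1))).withDensity
          (fun xhat => ENNReal.ofReal
            ((PseudoEquilibrium.partitionZtilde (m + 2) ρ ε σ)⁻¹ *
              Real.exp (-((m + 2 : ℕ) : ℝ) * PseudoEquilibrium.hamiltonianHat m V xhat))) ∧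
      (∀ xhat ∈ PseudoEquilibrium.ordered (m + 1), ∀ v : Fin (m + 1) → ℝ,
        (PseudoEquilibrium.scaleR (m + 2) ρ ε ^ 2)⁻¹ * ∑ i, v i ^ 2 ≤
          iteratedFDeriv ℝ 2 V xhat ![v, v]) := by
  refine ⟨PseudoEquilibrium.isProbabilityMeasure_omega (by omega) ρ ε σ,
    PseudoEquilibrium.potentialHat m ρ ε σ, PseudoEquilibrium.contDiffOn_potentialHat m ρ ε σ,
    fun xhat hx => PseudoEquilibrium.omegaHatDensity_eq m ρ ε σ hx, ?_,
    fun xhat hx v => PseudoEquilibrium.le_iteratedFDeriv_two_of_convexOn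
      (PseudoEquilibrium.isOpen_ordered _) (PseudoEquilibrium.contDiffOn_potentialHat m ρ ε σ)
      (PseudoEquilibrium.convexOn_potentialHat_sub m ρ ε σ) hx v⟩
  rw [PseudoEquilibrium.omegaHat_eq_withDensity]
  -- The exponential formula is available only on the ordered cone, which has full measure for the
  -- restricted volume.
  refine MeasureTheory.withDensity_congr_ae ?_
  filter_upwards [MeasureTheory.ae_restrict_mem
    (PseudoEquilibrium.isOpen_ordered (m + 1)).measurableSet] with x hx
  rw [PseudoEquilibrium.omegaHatDensity_eq m ρ ε σ hx]
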